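/- Let $G=(V,E)$ be a finite simple planar graph (one that can be drawn in the plane with vertices as distinct points and edges as simple arcs that meet only at common endpoints) with minimum degree at least $3$, and let $V = T \sqcup W$ be a partition of its vertices into a set $T$ of terminals and a set $W$ of white vertices (either part may be empty). Suppose that $W$ is a stable set, i.e. no two vertices of $W$ are adjacent. Then there exists a terminal $t\in T$ of degree at most $10$ in $G$ that has at most $5$ neighbours in $T$. -/

import Mathlib

/-- `A` is a simple (Jordan) arc in the plane with endpoints `p` and `q`: the image of an injective
continuous map from `[0, 1]` that starts at `p` and ends at `q`. The plane `ℝ²` is represented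
by `ℂ`, which carries the Euclidean topology. -/
def IsPlaneArc (A : Set ℂ) (p q : ℂ) : Prop :=
  ∃ γ : unitInterval → ℂ,
    Continuous γ ∧ Function.Injective γ ∧ γ 0 = p ∧ γ 1 = q ∧ Set.range γ = A

/-- A drawing of the graph `G` in the plane without crossings: vertices are distinct points, every
edge `uv` is a simple arc joining the points of `u` and `v`, an arc contains no vertex other than
the ends of its edge, and two distinct arcs meet only in common ends of their edges. -/
structure PlaneDrawing {V : Type*} (G : SimpleGraph V) where
  /-- The point that represents a vertex. -/
  point : V → ℂ
  /-- The arc that represents an edge (values at pairs that are not edges play no role). -/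
  arc : Sym2 V → Set ℂ
  point_injective : Function.Injective point
  isPlaneArc : ∀ u v : V, G.Adj u v → IsPlaneArc (arc s(u, v)) (point u) (point v)
  mem_of_point_mem : ∀ e ∈ G.edgeSet, ∀ w : V, point w ∈ arc e → w ∈ e
  inter_subset : ∀ e ∈ G.edgeSet, ∀ f ∈ G.edgeSet, e ≠ f →
    ∀ x ∈ arc e ∩ arc f, ∃ v : V, v ∈ e ∧ v ∈ f ∧ point v = x

/-- A graph is planar if it has a drawing in the plane without crossings. -/
def IsPlanarGraph {V : Type*} (G : SimpleGraph V) : Prop :=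
  Nonempty (PlaneDrawing G)

/-! Call an edge inner if both ends lie in `T` and outer otherwise, and suppose that every terminal
has at least six inner or at least six outer edges. For a terminal `t` and a face, let the excess be
the number of outer minus the number of inner boundary edges at `t`, truncated at 0. Every edge lies
on two face boundaries or has the same face on both sides; up to a correction for the latter kind,
twice the inner degree of `t` plus its excess over all faces is therefore at least 12. A face with
`k` boundary edges has total excess at most `4k - 12` (`sum_outer_sub_inner_add_le`): stability of
`W` forces `k ≥ 4` as soon as some excess is positive. Summing and inserting `|F| ≥ |E| - |V| + 2`,
one finds that four times the number of outer edges plus 24 is at most `12|W|`, against minimum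
degree 3. This is `exists_card_innerEdgesAt_le`.

The topology enters through two facts modulo 2: face boundaries are even, and every even subgraph is
a sum of face boundaries. The second gives Euler's inequality by counting dimensions
(`card_edges_add_two_le`). To obtain both, the drawing is discretized into a minor of the square
grid (`IsPlanarGraph.exists_grid_minor`). Faces are then classes of unit squares, and the two facts
follow from the corresponding statements about the grid (`exists_faces_of_grid_minor`). -/

/-! ### Chains modulo 2 on the square grid -/

/-- The unit step in direction `true` (horizontal) or `false` (vertical). -/
def gridStep : Bool → ℤ × ℤ
  | true => (1, 0)
  | false => (0, 1)

/-- An edge of the square grid `ℤ × ℤ`, given by its lower left end and its direction. -/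
abbrev GridEdge := (ℤ × ℤ) × Bool

namespace GridEdge

/-- The first end of a grid edge. -/
def src (E : GridEdge) : ℤ × ℤ := E.1

/-- The second end of a grid edge. -/
def tgt (E : GridEdge) : ℤ × ℤ := E.1 + gridStep E.2

/-- One of the two unit squares at a grid edge; squares are named by their lower left corner. -/
def left (E : GridEdge) : ℤ × ℤ := E.1

/-- The other unit square at a grid edge. -/
def right (E : GridEdge) : ℤ × ℤ := E.1 - gridStep (!E.2)

end GridEdge

open GridEdge

/-- The boundary map of the grid modulo 2. -/
noncomputable def gridBoundary : (GridEdge →₀ ZMod 2) →ₗ[ZMod 2] (ℤ × ℤ →₀ ZMod 2) :=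
  Finsupp.linearCombination (ZMod 2) fun E => Finsupp.single E.src 1 + Finsupp.single E.tgt 1

/-- The coboundary map of the grid modulo 2. -/
noncomputable def gridCoboundary : (ℤ × ℤ →₀ ZMod 2) →ₗ[ZMod 2] (GridEdge →₀ ZMod 2) :=
  Finsupp.linearCombination (ZMod 2) fun p =>
    Finsupp.single (p, true) 1 + Finsupp.single (p, false) 1 +
      Finsupp.single (p - gridStep true, true) 1 + Finsupp.single (p - gridStep false, false) 1

theorem gridBoundary_single (E : GridEdge) :
    gridBoundary (Finsupp.single E 1) = Finsupp.single E.src 1 + Finsupp.single E.tgt 1 := by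
  simp [gridBoundary]

theorem gridBoundary_apply (z : GridEdge →₀ ZMod 2) (p : ℤ × ℤ) :
    gridBoundary z p =
      z (p, true) + z (p, false) + z (p - gridStep true, true) + z (p - gridStep false, false) := by
  induction z using Finsupp.induction_linear with
  | zero => simp
  | add f g hf hg => rw [map_add, Finsupp.add_apply, hf, hg]; simp only [Finsupp.add_apply]; ring
  | single E c =>
    obtain ⟨q, d⟩ := E
    rw [gridBoundary, Finsupp.linearCombination_single]
    cases d <;> simp [Finsupp.single_apply, src, tgt, Prod.ext_iff, gridStep, eq_sub_iff_add_eq]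

theorem gridCoboundary_apply (b : ℤ × ℤ →₀ ZMod 2) (E : GridEdge) :
    gridCoboundary b E = b E.src + b E.tgt := by
  induction b using Finsupp.induction_linear with
  | zero => simp
  | add f g hf hg => rw [map_add, Finsupp.add_apply, hf, hg]; simp only [Finsupp.add_apply]; ring
  | single p c =>
    obtain ⟨q, d⟩ := E
    rw [gridCoboundary, Finsupp.linearCombination_single]
    cases d <;> simp [Finsupp.single_apply, src, tgt, Prod.ext_iff, gridStep, sub_eq_iff_eq_add]

/-- The edges around a grid point cross the boundary of any set of squares an even number of
times. -/
theorem linearCombination_gridCoboundary (χ : ℤ × ℤ → ZMod 2) (b : ℤ × ℤ →₀ ZMod 2) :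
    Finsupp.linearCombination (ZMod 2) (fun E : GridEdge => χ E.left + χ E.right)
      (gridCoboundary b) = 0 := by
  induction b using Finsupp.induction_linear with
  | zero => simp
  | add f g hf hg => rw [map_add, map_add, hf, hg, add_zero]
  | single p c =>
    -- The variables are the values of `χ` on the four squares around `p`; each square borders two
    -- of the four edges at `p`.
    have key : ∀ x y z w : ZMod 2, (x + y) + (x + z) + (z + w) + (y + w) = 0 := by decide
    rw [gridCoboundary, Finsupp.linearCombination_single, map_smul]
    simp only [map_add, Finsupp.linearCombination_single, one_smul]
    have h := key (χ p) (χ (p - gridStep false)) (χ (p - gridStep true))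
      (χ (p - gridStep true - gridStep false))
    have h' : p - gridStep false - gridStep true = p - gridStep true - gridStep false := by abel
    simp only [left, right, Bool.not_true, Bool.not_false, h', h, smul_zero]

theorem Int.exists_antidifference {A : Type*} [AddCommGroup A] (f : ℤ → A) :
    ∃ F : ℤ → A, ∀ i, F i = F (i - 1) + f i := by
  refine ⟨fun i => ∑ k ∈ Finset.Ioc 0 i, f k - ∑ k ∈ Finset.Ioc i 0, f k, fun i => ?_⟩
  rcases le_or_gt 1 i with h | h
  · beta_reduce
    have h1 : Finset.Ioc 0 i = insert i (Finset.Ioc 0 (i - 1)) := by ext; simp; omega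
    have h2 : Finset.Ioc i 0 = ∅ := by ext; simp; omega
    have h3 : Finset.Ioc (i - 1) 0 = ∅ := by ext; simp; omega
    rw [h1, h2, h3, Finset.sum_insert (by simp)]
    simp [add_comm]
  · beta_reduce
    have h1 : Finset.Ioc (i - 1) 0 = insert i (Finset.Ioc i 0) := by ext; simp; omega
    have h2 : Finset.Ioc 0 i = ∅ := by ext; simp; omega
    have h3 : Finset.Ioc 0 (i - 1) = ∅ := by ext; simp; omega
    rw [h1, h2, h3, Finset.sum_insert (by simp)]
    simp

theorem Int.eq_of_sub_one_eq {A : Type*} (D : ℤ → A) (h : ∀ i, D i = D (i - 1)) (i : ℤ) :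
    D i = D 0 := by
  induction i using Int.induction_on with
  | zero => rfl
  | succ i ih => rw [h, add_sub_cancel_right, ih]
  | pred i ih => rw [← h, ih]

/-- A closed chain of the grid is the boundary of a set of squares. -/
theorem exists_potential_of_gridBoundary_eq_zero (z : GridEdge →₀ ZMod 2)
    (hz : gridBoundary z = 0) : ∃ g : ℤ × ℤ → ZMod 2, ∀ E, z E = g E.left + g E.right := by
  have hz' (i j : ℤ) :
      z ((i, j), true) + z ((i, j), false) + z ((i - 1, j), true) + z ((i, j - 1), false) = 0 := by
    simpa [gridStep] using (gridBoundary_apply z (i, j)).symm.trans (by rw [hz]; rfl)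
  -- The vertical edges of row `j` determine a potential on that row up to a constant; `Q` supplies
  -- these constants, read off from column 0.
  choose P hP using fun j => Int.exists_antidifference fun i => z ((i, j), false)
  obtain ⟨Q, hQ⟩ := Int.exists_antidifference fun j => P j 0 + P (j - 1) 0 + z ((0, j), true)
  have key : ∀ x y x' y' h h' : ZMod 2, h + x + h' + y = 0 →
      (x' + x) + (y' + y) + h = x' + y' + h' := by decide
  -- Closedness of `z` at `(i, j)` makes the left side independent of `i`, so constants fitted in
  -- column 0 fit every column.
  have hD (i j : ℤ) : P j i + P (j - 1) i + z ((i, j), true) =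
      P j 0 + P (j - 1) 0 + z ((0, j), true) := by
    refine Int.eq_of_sub_one_eq (fun i => P j i + P (j - 1) i + z ((i, j), true)) (fun i => ?_) i
    rw [hP j i, hP (j - 1) i]
    exact key _ _ _ _ _ _ (hz' i j)
  refine ⟨fun p => P p.2 p.1 + Q p.2, ?_⟩
  have k1 : ∀ a b c d q : ZMod 2, a + b + c = d → c = a + (q + d) + (b + q) := by decide
  have k2 : ∀ a b q : ZMod 2, b = (a + b + q) + (a + q) := by decide
  rintro ⟨⟨i, j⟩, d⟩
  cases d
  · simp only [left, right, gridStep, Bool.not_false, Prod.mk_sub_mk, sub_zero]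
    rw [hP j i]
    exact k2 _ _ _
  · simp only [left, right, gridStep, Bool.not_true, Prod.mk_sub_mk, sub_zero]
    rw [hQ j]
    exact k1 _ _ _ _ _ (hD i j)

/-! ### Grid walks -/

/-- The two grid points are the ends of a grid edge. -/
def GridAdj (p q : ℤ × ℤ) : Prop :=
  ∃ E : GridEdge, (E.src = p ∧ E.tgt = q) ∨ (E.src = q ∧ E.tgt = p)

theorem GridAdj.symm {p q : ℤ × ℤ} (h : GridAdj p q) : GridAdj q p :=
  h.imp fun _ => Or.symm

/-- The two grid points are joined by a grid walk inside the set `S`. -/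
def GridLinked (S : Set (ℤ × ℤ)) : ℤ × ℤ → ℤ × ℤ → Prop :=
  Relation.ReflTransGen fun p q => GridAdj p q ∧ p ∈ S ∧ q ∈ S

/-- Any two points of `S` are joined by a grid walk inside `S`. -/
def GridConnected (S : Set (ℤ × ℤ)) : Prop :=
  ∀ p ∈ S, ∀ q ∈ S, GridLinked S p q

theorem GridLinked.symm {S : Set (ℤ × ℤ)} {p q : ℤ × ℤ} (h : GridLinked S p q) :
    GridLinked S q p :=
  have : Std.Symm fun p q => GridAdj p q ∧ p ∈ S ∧ q ∈ S :=
    ⟨fun _ _ h => ⟨h.1.symm, h.2.2, h.2.1⟩⟩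
  Relation.ReflTransGen.stdSymm.symm _ _ h

theorem GridLinked.mono {S S' : Set (ℤ × ℤ)} (hS : S ⊆ S') {p q : ℤ × ℤ} (h : GridLinked S p q) :
    GridLinked S' p q :=
  Relation.ReflTransGen.mono (fun _ _ h => ⟨h.1, hS h.2.1, hS h.2.2⟩) _ _ h

/-- Take the sum modulo 2 of the edges of the walk: intermediate points cancel in the boundary. -/
theorem GridLinked.exists_chain {S : Set (ℤ × ℤ)} {p q : ℤ × ℤ} (h : GridLinked S p q) :
    ∃ z : GridEdge →₀ ZMod 2, gridBoundary z = Finsupp.single p 1 + Finsupp.single q 1 ∧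
      ∀ E, z E ≠ 0 → E.src ∈ S ∧ E.tgt ∈ S := by
  have two (x : ℤ × ℤ →₀ ZMod 2) : x + x = 0 := by
    ext i; exact CharTwo.add_self_eq_zero _
  induction h with
  | refl => exact ⟨0, by simp [two], by simp⟩
  | @tail b c _ hbc ih =>
    obtain ⟨z, hz, hzS⟩ := ih
    obtain ⟨⟨E, hE⟩, hb, hc⟩ := hbc
    have hEb : gridBoundary (Finsupp.single E 1) = Finsupp.single b 1 + Finsupp.single c 1 := by
      rw [gridBoundary_single]
      rcases hE with ⟨h1, h2⟩ | ⟨h1, h2⟩ <;> rw [h1, h2]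
      exact add_comm _ _
    refine ⟨z + Finsupp.single E 1, ?_, fun E' hE' => ?_⟩
    · rw [map_add, hz, hEb, add_assoc, ← add_assoc (Finsupp.single b 1), two, zero_add]
    · by_cases hEE : E = E'
      · subst hEE
        rcases hE with ⟨h1, h2⟩ | ⟨h1, h2⟩ <;> rw [h1, h2] <;> exact ⟨‹_›, ‹_›⟩
      · refine hzS E' ?_
        simpa [Finsupp.single_apply, hEE] using hE'

/-! ### Faces of a grid minor -/

/-- A minor of the square grid has a system of faces: every edge `e` lies between the faces `l e`
and `r e`, every face boundary is an even subgraph, and every even subgraph is a sum of face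
boundaries. -/
theorem exists_faces_of_grid_minor {V : Type*} [Fintype V] [DecidableEq V] (G : SimpleGraph V)
    [Fintype G.edgeSet] (B : V → Set (ℤ × ℤ)) (hfin : ∀ v, (B v).Finite)
    (hconn : ∀ v, GridConnected (B v)) (hdisj : ∀ u v p, p ∈ B u → p ∈ B v → u = v)
    (hadj : ∀ e ∈ G.edgeSet, ∃ (E : GridEdge) (u v : V),
      e = s(u, v) ∧ E.src ∈ B u ∧ E.tgt ∈ B v) :
    ∃ (Φ : Type) (l r : Sym2 V → Φ),
      (∀ (χ : Φ → ZMod 2) (v : V), ∑ e ∈ G.edgeFinset with v ∈ e, (χ (l e) + χ (r e)) = 0) ∧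
      ∀ z : Sym2 V → ZMod 2, (∀ v, ∑ e ∈ G.edgeFinset with v ∈ e, z e = 0) →
        ∃ g : Φ → ZMod 2, ∀ e ∈ G.edgeSet, z e = g (l e) + g (r e) := by
  classical
  choose! η a b he hsrc htgt using hadj
  have hab : ∀ e (h : e ∈ G.edgeSet), a e h ≠ b e h := by
    intro e h hab
    have := he e h
    rw [hab] at this
    rw [this] at h
    exact G.loopless.irrefl _ h
  have hinj : ∀ e ∈ G.edgeSet, ∀ f ∈ G.edgeSet, η e = η f → e = f := by
    intro e h f h' hef
    have h1 := hdisj _ _ _ (hsrc e h) (hef ▸ hsrc f h')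
    have h2 := hdisj _ _ _ (htgt e h) (hef ▸ htgt f h')
    rw [he e h, he f h', h1, h2]
  -- The edges in `K` act as walls: they represent edges of `G` or run inside a branch set. Faces
  -- are the classes of squares under crossing grid edges that are not walls.
  let K : Set GridEdge := {E | (∃ e ∈ G.edgeSet, η e = E) ∨ ∃ v, E.src ∈ B v ∧ E.tgt ∈ B v}
  let R : ℤ × ℤ → ℤ × ℤ → Prop := fun c c' => ∃ E, E ∉ K ∧ E.left = c ∧ E.right = c'
  refine ⟨Quot R, fun e => Quot.mk R (η e).left, fun e => Quot.mk R (η e).right, ?_, ?_⟩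
  -- The coboundary of the indicator of `B v` consists of the grid edges leaving `B v`. Those in `K`
  -- are exactly the `η e` with `v ∈ e`; the others have the same face on both sides and contribute
  -- 0.
  · intro χ v
    let β : ℤ × ℤ →₀ ZMod 2 := Finsupp.indicator (hfin v).toFinset fun _ _ => 1
    have hβ (p : ℤ × ℤ) : β p = if p ∈ B v then 1 else 0 := by
      simp [β, Finsupp.indicator_apply]
    have hsum := linearCombination_gridCoboundary (fun c => χ (Quot.mk R c)) β
    rw [Finsupp.linearCombination_apply, Finsupp.sum] at hsum
    rw [← hsum]
    have hone : ∀ e ∈ G.edgeSet, v ∈ e → gridCoboundary β (η e) = 1 := by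
      intro e h hv
      rw [gridCoboundary_apply, hβ, hβ]
      rw [he e h, Sym2.mem_iff] at hv
      rcases hv with rfl | hv
      · have h1 := hsrc e h
        rw [if_pos h1, if_neg fun h2 => hab e h (hdisj _ _ _ h2 (htgt e h)), add_zero]
      · rw [hv, if_pos (htgt e h), if_neg fun h2 => hab e h (hdisj _ _ _ (hsrc e h) h2), zero_add]
    refine Finset.sum_of_injOn η ?_ ?_ ?_ ?_
    · intro e h f h' hef
      simp only [Finset.coe_filter, SimpleGraph.mem_edgeFinset, Set.mem_ofPred_eq] at h h'
      exact hinj e h.1 f h'.1 hef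
    · intro e h
      simp only [Finset.coe_filter, SimpleGraph.mem_edgeFinset, Set.mem_ofPred_eq] at h
      simp [hone e h.1 h.2]
    · intro E hE hE'
      by_cases hK : E ∈ K
      · exfalso
        rw [Finsupp.mem_support_iff, gridCoboundary_apply, hβ, hβ] at hE
        rcases hK with ⟨e, h, rfl⟩ | ⟨w, h1, h2⟩
        · refine hE' ⟨e, ?_, rfl⟩
          simp only [Finset.coe_filter, SimpleGraph.mem_edgeFinset, Set.mem_ofPred_eq]
          refine ⟨h, ?_⟩
          rw [he e h, Sym2.mem_iff]
          by_contra hv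
          push Not at hv
          rw [if_neg fun h1 => hv.1 (hdisj _ _ _ h1 (hsrc e h)),
            if_neg fun h1 => hv.2 (hdisj _ _ _ h1 (htgt e h))] at hE
          exact hE (add_zero _)
        · by_cases hv : v = w
          · subst hv
            rw [if_pos h1, if_pos h2] at hE
            exact hE (CharTwo.add_self_eq_zero _)
          · rw [if_neg fun h => hv (hdisj _ _ _ h h1), if_neg fun h => hv (hdisj _ _ _ h h2)] at hE
            exact hE (add_zero _)
      · have : Quot.mk R E.left = Quot.mk R E.right := Quot.sound ⟨E, hK, rfl, rfl⟩
        simp only [this, CharTwo.add_self_eq_zero, smul_zero]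
    · intro e h
      simp only [Finset.mem_filter, SimpleGraph.mem_edgeFinset] at h
      rw [hone e h.1 h.2, one_smul]
  · intro z hz
    have hroot : ∀ v, ∃ ρ, ∀ p ∈ B v, GridLinked (B v) p ρ := by
      intro v
      rcases (B v).eq_empty_or_nonempty with h | ⟨ρ, hρ⟩
      · exact ⟨0, by simp [h]⟩
      · exact ⟨ρ, fun p hp => hconn v p hp ρ hρ⟩
    choose ρ hρ using hroot
    have two (x : ℤ × ℤ →₀ ZMod 2) : x + x = 0 := by
      ext i; exact CharTwo.add_self_eq_zero _
    -- Realize `e` by a chain from root to root: through one branch set, across `η e`, through the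
    -- other. An even `z` then yields a closed chain supported on `K`.
    have hchain : ∀ e ∈ G.edgeSet, ∃ c : GridEdge →₀ ZMod 2,
        gridBoundary c = ∑ v with v ∈ e, Finsupp.single (ρ v) 1 ∧ c (η e) = 1 ∧
        ∀ E, c E ≠ 0 → E ≠ η e → ∃ v, E.src ∈ B v ∧ E.tgt ∈ B v := by
      intro e h
      obtain ⟨c₁, h₁, h₁'⟩ := (hρ _ _ (hsrc e h)).exists_chain
      obtain ⟨c₂, h₂, h₂'⟩ := (hρ _ _ (htgt e h)).exists_chain
      refine ⟨c₁ + Finsupp.single (η e) 1 + c₂, ?_, ?_, ?_⟩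
      · have : (Finset.univ.filter fun v => v ∈ e) = {a e h, b e h} := by
          ext v
          conv_lhs => rw [he e h]
          simp
        rw [this, Finset.sum_pair (hab e h), map_add, map_add, h₁, h₂, gridBoundary_single]
        generalize Finsupp.single (ρ (a e h)) (1 : ZMod 2) = x
        generalize Finsupp.single (ρ (b e h)) (1 : ZMod 2) = y
        generalize Finsupp.single (η e).src (1 : ZMod 2) = s
        generalize Finsupp.single (η e).tgt (1 : ZMod 2) = t
        calc s + x + (s + t) + (t + y) = (s + s) + (t + t) + (x + y) := by abel
          _ = x + y := by rw [two, two, zero_add, zero_add]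
      · have e1 : c₁ (η e) = 0 := by
          by_contra h0
          exact hab e h (hdisj _ _ _ (h₁' _ h0).2 (htgt e h))
        have e2 : c₂ (η e) = 0 := by
          by_contra h0
          exact hab e h (hdisj _ _ _ (hsrc e h) (h₂' _ h0).1)
        simp [e1, e2]
      · intro E hE hne
        by_cases h0 : c₁ E = 0
        · refine ⟨_, h₂' E fun h0' => hE ?_⟩
          simp [h0, h0', hne.symm]
        · exact ⟨_, h₁' E h0⟩
    choose! c hc hc1 hc0 using hchain
    have hcη : ∀ e ∈ G.edgeSet, ∀ f ∈ G.edgeSet, f ≠ e → c f (η e) = 0 := by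
      intro e h f h' hne
      by_contra h0
      obtain ⟨v, h1, h2⟩ := hc0 f h' (η e) h0 fun h3 => hne (hinj e h f h' h3).symm
      exact hab e h ((hdisj _ _ _ (hsrc e h) h1).trans (hdisj _ _ _ h2 (htgt e h)))
    obtain ⟨g, hg⟩ := exists_potential_of_gridBoundary_eq_zero
      (∑ e ∈ G.edgeFinset, z e • c e) (by
        rw [map_sum]
        calc ∑ e ∈ G.edgeFinset, gridBoundary (z e • c e)
            = ∑ e ∈ G.edgeFinset, ∑ v, if v ∈ e then z e • Finsupp.single (ρ v) (1 : ZMod 2)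
                else 0 := by
              refine Finset.sum_congr rfl fun e h => ?_
              rw [map_smul, hc e (SimpleGraph.mem_edgeFinset.1 h), Finset.smul_sum,
                Finset.sum_filter]
          _ = ∑ v, (∑ e ∈ G.edgeFinset with v ∈ e, z e) • Finsupp.single (ρ v) (1 : ZMod 2) := by
              rw [Finset.sum_comm]
              refine Finset.sum_congr rfl fun v _ => ?_
              rw [Finset.sum_smul, Finset.sum_filter]
          _ = 0 := by simp [hz])
    -- The closed chain vanishes off the walls, so its potential descends to faces.
    have hgR : ∀ p q, R p q → g p = g q := by
      rintro _ _ ⟨E, hEK, rfl, rfl⟩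
      have h0 : (∑ e ∈ G.edgeFinset, z e • c e) E = 0 := by
        rw [Finsupp.finsetSum_apply]
        refine Finset.sum_eq_zero fun e h => ?_
        rw [SimpleGraph.mem_edgeFinset] at h
        rw [Finsupp.smul_apply]
        by_cases h0 : c e E = 0
        · rw [h0, smul_zero]
        · exact absurd (Or.inr (hc0 e h E h0 fun h1 => hEK (Or.inl ⟨e, h, h1.symm⟩))) hEK
      rw [hg E] at h0
      exact CharTwo.add_eq_zero.1 h0
    refine ⟨Quot.lift g hgR, fun e h => ?_⟩
    refine Eq.trans ?_ (hg (η e))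
    rw [Finsupp.finsetSum_apply, Finset.sum_eq_single e]
    · simp [hc1 e h]
    · intro f h' hne
      rw [Finsupp.smul_apply, hcη e h f (SimpleGraph.mem_edgeFinset.1 h') hne, smul_zero]
    · intro h'
      exact absurd (SimpleGraph.mem_edgeFinset.2 h) h'

/-! ### Discretizing subsets of the plane -/

/-- The lattice points at sup-distance less than one from the `n`-fold dilation of `C`. -/
def latticeNhd (n : ℝ) (C : Set ℂ) : Set (ℤ × ℤ) :=
  {p | ∃ z ∈ C, |n * z.re - p.1| < 1 ∧ |n * z.im - p.2| < 1}

theorem exists_lattice_point_near (n : ℝ) (z : ℂ) :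
    ∃ p : ℤ × ℤ, |n * z.re - p.1| < 1 ∧ |n * z.im - p.2| < 1 := by
  refine ⟨(⌊n * z.re⌋, ⌊n * z.im⌋), ?_, ?_⟩ <;> simp only [Int.self_sub_floor] <;>
    rw [abs_of_nonneg (Int.fract_nonneg _)] <;> exact Int.fract_lt_one _

theorem finite_latticeNhd (n : ℝ) {C : Set ℂ} (hC : IsCompact C) : (latticeNhd n C).Finite := by
  obtain ⟨M, hM⟩ := hC.isBounded.exists_norm_le
  let k : ℤ := ⌈|n| * M + 1⌉
  refine Set.Finite.subset ((Set.finite_Icc (-k) k).prod (Set.finite_Icc (-k) k)) ?_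
  have key : ∀ (x : ℝ) (i : ℤ), |x| ≤ M → |n * x - i| < 1 → i ∈ Set.Icc (-k) k := by
    intro x i hx hi
    have h1 : |n * x| ≤ |n| * M := by
      rw [abs_mul]; exact mul_le_mul_of_nonneg_left hx (abs_nonneg n)
    have h2 : |n| * M + 1 ≤ k := Int.le_ceil _
    rw [abs_lt] at hi
    rw [abs_le] at h1
    constructor
    · have : (-k : ℝ) ≤ i := by linarith
      exact_mod_cast this
    · have : (i : ℝ) ≤ k := by linarith
      exact_mod_cast this
  rintro ⟨i, j⟩ ⟨z, hz, h1, h2⟩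
  exact ⟨key _ _ ((Complex.abs_re_le_norm z).trans (hM z hz)) h1,
    key _ _ ((Complex.abs_im_le_norm z).trans (hM z hz)) h2⟩

theorem GridLinked.of_step {S : Set (ℤ × ℤ)} {p q : ℤ × ℤ} (d : Bool) (hp : p ∈ S) (hq : q ∈ S)
    (h : p = q ∨ p + gridStep d = q ∨ q + gridStep d = p) : GridLinked S p q := by
  rcases h with rfl | h | h
  · exact .refl
  · exact .single ⟨⟨(p, d), Or.inl ⟨rfl, h⟩⟩, hp, hq⟩
  · exact .single ⟨⟨(q, d), Or.inr ⟨rfl, h⟩⟩, hp, hq⟩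

/-- Integers within distance less than 1 of the same real differ by at most 1, so one coordinate can
be changed at a time; the intermediate corner is also near `z`. -/
theorem gridLinked_of_near {n : ℝ} {C : Set ℂ} {z : ℂ} (hz : z ∈ C) {p q : ℤ × ℤ}
    (hp : |n * z.re - p.1| < 1 ∧ |n * z.im - p.2| < 1)
    (hq : |n * z.re - q.1| < 1 ∧ |n * z.im - q.2| < 1) : GridLinked (latticeNhd n C) p q := by
  have key : ∀ (x : ℝ) (i j : ℤ), |x - i| < 1 → |x - j| < 1 → i = j ∨ i + 1 = j ∨ j + 1 = i := by
    intro x i j hi hj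
    rw [abs_lt] at hi hj
    have h1 : (i : ℝ) < j + 2 := by linarith
    have h2 : (j : ℝ) < i + 2 := by linarith
    have h1' : i < j + 2 := by exact_mod_cast h1
    have h2' : j < i + 2 := by exact_mod_cast h2
    omega
  obtain ⟨p1, p2⟩ := p
  obtain ⟨q1, q2⟩ := q
  have hm : (q1, p2) ∈ latticeNhd n C := ⟨z, hz, hq.1, hp.2⟩
  refine Relation.ReflTransGen.trans (b := (q1, p2))
    (GridLinked.of_step true ⟨z, hz, hp⟩ hm ?_) (GridLinked.of_step false hm ⟨z, hz, hq⟩ ?_)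
  · simpa [gridStep] using key _ _ _ hp.1 hq.1
  · simpa [gridStep] using key _ _ _ hp.2 hq.2

/-- The lattice points linked to `p` and those not linked to `p` have open neighbourhoods that
together cover `C`. Were both to meet `C`, they would share a point of `C`, and all lattice points
near one such point are linked. -/
theorem gridConnected_latticeNhd (n : ℝ) {C : Set ℂ} (hC : IsPreconnected C) :
    GridConnected (latticeNhd n C) := by
  rintro p ⟨z, hz, hp⟩ q ⟨w, hw, hq⟩
  by_contra hpq
  have hopen : ∀ X : Set (ℤ × ℤ),
      IsOpen {z : ℂ | ∃ p ∈ X, |n * z.re - p.1| < 1 ∧ |n * z.im - p.2| < 1} := by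
    intro X
    have : {z : ℂ | ∃ p ∈ X, |n * z.re - p.1| < 1 ∧ |n * z.im - p.2| < 1} =
        ⋃ p ∈ X, ({z : ℂ | |n * z.re - p.1| < 1} ∩ {z : ℂ | |n * z.im - p.2| < 1}) := by
      ext; simp only [Set.mem_iUnion, Set.mem_inter_iff, Set.mem_ofPred_eq, exists_prop]
    rw [this]
    refine isOpen_biUnion fun p _ => IsOpen.inter ?_ ?_
    · exact isOpen_lt (by fun_prop) continuous_const
    · exact isOpen_lt (by fun_prop) continuous_const
  obtain ⟨x, hx, ⟨a, ha, hax⟩, ⟨b, hb, hbx⟩⟩ :=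
    hC _ _ (hopen {a | GridLinked (latticeNhd n C) p a})
      (hopen {a | ¬ GridLinked (latticeNhd n C) p a}) (fun x _ => by
        obtain ⟨a, ha⟩ := exists_lattice_point_near n x
        by_cases h : GridLinked (latticeNhd n C) p a
        · exact Or.inl ⟨a, h, ha⟩
        · exact Or.inr ⟨a, h, ha⟩) ⟨z, hz, p, .refl, hp⟩ ⟨w, hw, q, hpq, hq⟩
  exact hb (Relation.ReflTransGen.trans ha (gridLinked_of_near hx hax hbx))

theorem eventually_disjoint_latticeNhd {C C' : Set ℂ} (hC : IsCompact C) (hC' : IsCompact C')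
    (h : Disjoint C C') : ∀ᶠ n : ℝ in Filter.atTop, Disjoint (latticeNhd n C) (latticeNhd n C') := by
  obtain ⟨δ, hδ, hd⟩ := Metric.exists_pos_forall_lt_edist hC hC'.isClosed h
  -- A common lattice point puts the dilated points less than 2 apart in each coordinate, hence at
  -- distance less than 4, whereas their distance exceeds `n * δ`.
  filter_upwards [Filter.eventually_ge_atTop (4 / (δ : ℝ))] with n hn
  rw [Set.disjoint_left]
  rintro p ⟨z, hz, hz1, hz2⟩ ⟨w, hw, hw1, hw2⟩
  have hδ' : (0 : ℝ) < δ := hδ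
  have h1 : (δ : ℝ) < dist z w := by
    have := hd z hz w hw
    rw [edist_nndist] at this
    exact_mod_cast this
  have hn0 : 0 < n := lt_of_lt_of_le (by positivity) hn
  rw [div_le_iff₀ hδ'] at hn
  have h2 : n * dist z w ≤ |n * z.re - n * w.re| + |n * z.im - n * w.im| := by
    rw [← mul_sub, ← mul_sub, abs_mul, abs_mul, abs_of_pos hn0, ← mul_add, dist_eq_norm]
    exact mul_le_mul_of_nonneg_left (Complex.norm_le_abs_re_add_abs_im _) hn0.le
  have h3 := mul_lt_mul_of_pos_left h1 hn0
  have h4 : |n * z.re - n * w.re| < 2 := by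
    rw [abs_lt] at *; constructor <;> linarith
  have h5 : |n * z.im - n * w.im| < 2 := by
    rw [abs_lt] at *; constructor <;> linarith
  linarith

/-! ### From links to a grid minor -/

/-- The points that can be reached from `A` by a grid walk in `S`. -/
def gridReach (S A : Set (ℤ × ℤ)) : Set (ℤ × ℤ) :=
  {q | ∃ a ∈ A, GridLinked S a q}

theorem gridReach_subset {S A : Set (ℤ × ℤ)} (hA : A ⊆ S) : gridReach S A ⊆ S := by
  rintro q ⟨a, ha, h⟩
  induction h with
  | refl => exact hA ha
  | tail _ h _ => exact h.2.2

theorem subset_gridReach (S A : Set (ℤ × ℤ)) : A ⊆ gridReach S A :=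
  fun a ha => ⟨a, ha, .refl⟩

theorem exists_gridLinked_gridReach {S A : Set (ℤ × ℤ)} {q : ℤ × ℤ} (hq : q ∈ gridReach S A) :
    ∃ a ∈ A, GridLinked (gridReach S A) a q := by
  obtain ⟨a, ha, h⟩ := hq
  refine ⟨a, ha, ?_⟩
  induction h with
  | refl => exact .refl
  | tail h h' ih => exact ih.tail ⟨h'.1, ⟨a, ha, h⟩, ⟨a, ha, h.tail h'⟩⟩

/-- A connected set that meets `A` and `A'` leads from `A` to a neighbour of `A'`. -/
theorem exists_gridAdj_gridReach {P A A' : Set (ℤ × ℤ)} (hP : GridConnected P)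
    (hA : (P ∩ A).Nonempty) (hA' : (P ∩ A').Nonempty) (hAA' : Disjoint A A') :
    ∃ p ∈ gridReach ((P ∪ A) \ A') A, ∃ q ∈ A', GridAdj p q := by
  obtain ⟨a, haP, ha⟩ := hA
  obtain ⟨b, hbP, hb⟩ := hA'
  have hsub : A ⊆ (P ∪ A) \ A' := fun x hx => ⟨Or.inr hx, Set.disjoint_left.1 hAA' hx⟩
  have key : ∀ c, GridLinked P a c → c ∈ gridReach ((P ∪ A) \ A') A ∨
      ∃ p ∈ gridReach ((P ∪ A) \ A') A, ∃ q ∈ A', GridAdj p q := by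
    intro c hc
    induction hc with
    | refl => exact Or.inl (subset_gridReach _ _ ha)
    | @tail c d _ hcd ih =>
      refine ih.elim (fun hc => ?_) Or.inr
      by_cases hd : d ∈ A'
      · exact Or.inr ⟨c, hc, d, hd, hcd.1⟩
      · have hcS := gridReach_subset hsub hc
        obtain ⟨x, hx, hxc⟩ := hc
        exact Or.inl ⟨x, hx, hxc.tail ⟨hcd.1, hcS, Or.inl hcd.2.2, hd⟩⟩
  exact (key b (hP a haP b hbP)).resolve_left fun h => (gridReach_subset hsub h).2 hb

/-- A system of disjoint connected sets, one for every vertex, and of disjoint connected links,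
one for every edge, gives a minor of the grid. -/
theorem exists_grid_minor_of_links {V : Type*} [Finite V] (G : SimpleGraph V)
    (B : V → Set (ℤ × ℤ)) (P : Sym2 V → Set (ℤ × ℤ))
    (hBfin : ∀ v, (B v).Finite) (hPfin : ∀ e ∈ G.edgeSet, (P e).Finite)
    (hBconn : ∀ v, GridConnected (B v)) (hPconn : ∀ e ∈ G.edgeSet, GridConnected (P e))
    (hBB : ∀ u v, u ≠ v → Disjoint (B u) (B v))
    (hPP : ∀ e ∈ G.edgeSet, ∀ f ∈ G.edgeSet, e ≠ f → Disjoint (P e) (P f))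
    (hPB : ∀ e ∈ G.edgeSet, ∀ v, v ∉ e → Disjoint (P e) (B v))
    (hmeet : ∀ e ∈ G.edgeSet, ∀ v ∈ e, (P e ∩ B v).Nonempty) :
    ∃ B' : V → Set (ℤ × ℤ), (∀ v, (B' v).Finite) ∧ (∀ v, GridConnected (B' v)) ∧
      (∀ u v p, p ∈ B' u → p ∈ B' v → u = v) ∧
      ∀ e ∈ G.edgeSet, ∃ (E : GridEdge) (u v : V), e = s(u, v) ∧ E.src ∈ B' u ∧ E.tgt ∈ B' v := by
  have hends : ∀ e : Sym2 V, ∃ x y, e = s(x, y) := Sym2.ind fun x y => ⟨x, y, rfl⟩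
  choose x y hxy using hends
  have hmem (e) (v) : v ∈ e ↔ v = x e ∨ v = y e := by
    conv_lhs => rw [hxy e]
    exact Sym2.mem_iff
  have hx (e) : x e ∈ e := (hmem e _).2 (Or.inl rfl)
  have hy (e) : y e ∈ e := (hmem e _).2 (Or.inr rfl)
  have hne : ∀ e ∈ G.edgeSet, x e ≠ y e := by
    intro e h hab
    rw [hxy e, hab] at h
    exact G.loopless.irrefl _ h
  -- The end `x e` absorbs the part of the link reachable before `B (y e)`. A link may overlap both
  -- of its ends, so removing `B (y e)` is what keeps the new branch sets disjoint.
  let Q : Sym2 V → Set (ℤ × ℤ) := fun e => gridReach ((P e ∪ B (x e)) \ B (y e)) (B (x e))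
  have hQS : ∀ e ∈ G.edgeSet, Q e ⊆ (P e ∪ B (x e)) \ B (y e) := fun e h =>
    gridReach_subset fun p hp => ⟨Or.inr hp, Set.disjoint_left.1 (hBB _ _ (hne e h)) hp⟩
  let B' : V → Set (ℤ × ℤ) := fun v => B v ∪ ⋃ e ∈ {e | e ∈ G.edgeSet ∧ x e = v}, Q e
  have hQB' : ∀ e ∈ G.edgeSet, Q e ⊆ B' (x e) := fun e h =>
    Set.subset_union_of_subset_right
      (Set.subset_biUnion_of_mem (s := {f | f ∈ G.edgeSet ∧ x f = x e}) (u := Q) ⟨h, rfl⟩) _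
  have hBB' : ∀ v, B v ⊆ B' v := fun v => Set.subset_union_left
  have hB' : ∀ v, ∀ p ∈ B' v,
      p ∈ B v ∨ ∃ e ∈ G.edgeSet, x e = v ∧ p ∈ Q e := by
    intro v p hp
    simpa [B', and_assoc] using hp
  refine ⟨B', fun v => ?_, fun v => ?_, fun u v p hu hv => ?_, fun e h => ?_⟩
  · refine (hBfin v).union (Set.Finite.biUnion (Set.toFinite _) ?_)
    rintro e ⟨h, rfl⟩
    exact ((hPfin e h).union (hBfin _)).subset ((hQS e h).trans Set.sdiff_subset)
  · have key : ∀ p ∈ B' v, ∃ a ∈ B v, GridLinked (B' v) a p := by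
      intro p hp
      rcases hB' v p hp with h | ⟨e, h, rfl, hpe⟩
      · exact ⟨p, h, .refl⟩
      · obtain ⟨a, ha, hap⟩ := exists_gridLinked_gridReach hpe
        exact ⟨a, ha, hap.mono (hQB' e h)⟩
    intro p hp q hq
    obtain ⟨a, ha, hap⟩ := key p hp
    obtain ⟨b, hb, hbq⟩ := key q hq
    exact Relation.ReflTransGen.trans hap.symm
      (Relation.ReflTransGen.trans ((hBconn v a ha b hb).mono (hBB' v)) hbq)
  · have hB'' : ∀ v, p ∈ B' v → p ∈ B v ∨ ∃ e ∈ G.edgeSet, x e = v ∧ p ∈ P e ∧ p ∉ B (y e) := by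
      intro v hp
      rcases hB' v p hp with h | ⟨e, h, rfl, hpe⟩
      · exact Or.inl h
      · obtain ⟨h1 | h1, h2⟩ := hQS e h hpe
        · exact Or.inr ⟨e, h, rfl, h1, h2⟩
        · exact Or.inl h1
    have hmix : ∀ u e, e ∈ G.edgeSet → p ∈ B u → p ∈ P e → p ∉ B (y e) → u = x e := by
      intro u e h hu hpe hpy
      by_contra hux
      refine Set.disjoint_left.1 (hPB e h u fun hue => ?_) hpe hu
      rw [hmem] at hue
      rcases hue with hue | hue
      · exact hux hue
      · exact hpy (hue ▸ hu)
    rcases hB'' u hu with hu | ⟨e, h, rfl, hpe, hpy⟩ <;>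
      rcases hB'' v hv with hv | ⟨f, h', rfl, hpf, hpy'⟩
    · by_contra huv
      exact Set.disjoint_left.1 (hBB u v huv) hu hv
    · exact hmix _ _ h' hu hpf hpy'
    · exact (hmix _ _ h hv hpe hpy).symm
    · by_contra hef
      exact Set.disjoint_left.1 (hPP e h f h' fun hef' => hef (hef' ▸ rfl)) hpe hpf
  · obtain ⟨p, hp, q, hq, E, hE⟩ := exists_gridAdj_gridReach (hPconn e h) (hmeet e h _ (hx e))
      (hmeet e h _ (hy e)) (hBB _ _ (hne e h))
    have hp' : p ∈ B' (x e) := hQB' e h hp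
    have hq' : q ∈ B' (y e) := hBB' _ hq
    rcases hE with ⟨rfl, rfl⟩ | ⟨rfl, rfl⟩
    · exact ⟨E, x e, y e, hxy e, hp', hq'⟩
    · exact ⟨E, y e, x e, (hxy e).trans Sym2.eq_swap, hq', hp'⟩

/-! ### From a plane drawing to a grid minor -/

/-- A planar graph is a minor of the square grid. -/
theorem IsPlanarGraph.exists_grid_minor {V : Type*} [Finite V] {G : SimpleGraph V}
    (hG : IsPlanarGraph G) :
    ∃ B : V → Set (ℤ × ℤ), (∀ v, (B v).Finite) ∧ (∀ v, GridConnected (B v)) ∧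
      (∀ u v p, p ∈ B u → p ∈ B v → u = v) ∧
      ∀ e ∈ G.edgeSet, ∃ (E : GridEdge) (u v : V), e = s(u, v) ∧ E.src ∈ B u ∧ E.tgt ∈ B v := by
  obtain ⟨D⟩ := hG
  have hends : ∀ e : Sym2 V, ∃ x y, e = s(x, y) := Sym2.ind fun x y => ⟨x, y, rfl⟩
  choose x y hxy using hends
  have hmem (e) (v) : v ∈ e ↔ v = x e ∨ v = y e := by
    conv_lhs => rw [hxy e]
    exact Sym2.mem_iff
  have harc : ∀ e ∈ G.edgeSet, IsPlaneArc (D.arc e) (D.point (x e)) (D.point (y e)) := by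
    intro e h
    have := D.isPlaneArc (x e) (y e) (by rw [← SimpleGraph.mem_edgeSet, ← hxy e]; exact h)
    rwa [← hxy e] at this
  choose! γ hcont hinj h0 h1 hrange using harc
  have hγarc : ∀ e ∈ G.edgeSet, ∀ t, γ e t ∈ D.arc e := fun e h t => hrange e h ▸ ⟨t, rfl⟩
  -- Cut every arc into thirds. The outer thirds join the stars `K v` around their ends, the middle
  -- third is the link `M e`; sets that must not touch are then disjoint compact sets, hence a
  -- positive distance apart.
  let c : unitInterval := ⟨1 / 3, by norm_num, by norm_num⟩
  let d : unitInterval := ⟨2 / 3, by norm_num, by norm_num⟩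
  have hcd : c < d := by rw [← Subtype.coe_lt_coe]; norm_num [c, d]
  have hc0 : 0 < c := by rw [← Subtype.coe_lt_coe]; norm_num [c]
  have hd1 : d < 1 := by rw [← Subtype.coe_lt_coe]; norm_num [d]
  let K : V → Set ℂ := fun v => {D.point v} ∪
    ⋃ e ∈ G.edgeSet, ((⋃ (_ : x e = v), γ e '' Set.Iic c) ∪ ⋃ (_ : y e = v), γ e '' Set.Ici d)
  let M : Sym2 V → Set ℂ := fun e => γ e '' Set.Icc c d
  have hK : ∀ v, ∀ z ∈ K v, z = D.point v ∨ ∃ e ∈ G.edgeSet, ∃ t,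
      ((t ≤ c ∧ x e = v) ∨ (d ≤ t ∧ y e = v)) ∧ γ e t = z := by
    rintro v z (hz | hz)
    · exact Or.inl hz
    · simp only [Set.mem_iUnion, Set.mem_union] at hz
      obtain ⟨e, h, ⟨hv, t, ht, rfl⟩ | ⟨hv, t, ht, rfl⟩⟩ := hz
      · exact Or.inr ⟨e, h, t, Or.inl ⟨ht, hv⟩, rfl⟩
      · exact Or.inr ⟨e, h, t, Or.inr ⟨ht, hv⟩, rfl⟩
  have hpt : ∀ e ∈ G.edgeSet, ∀ t w, γ e t = D.point w → (t = 0 ∧ w = x e) ∨ (t = 1 ∧ w = y e) := by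
    intro e h t w htw
    have hw := D.mem_of_point_mem e h w (htw ▸ hγarc e h t)
    rw [hmem] at hw
    rcases hw with rfl | rfl
    · exact Or.inl ⟨hinj e h (htw.trans (h0 e h).symm), rfl⟩
    · exact Or.inr ⟨hinj e h (htw.trans (h1 e h).symm), rfl⟩
  have hptK : ∀ v w, D.point w ∈ K v → w = v := by
    intro v w hw
    rcases hK v _ hw with h | ⟨e, h, t, ht, htw⟩
    · exact D.point_injective h
    · rcases hpt e h t w htw with ⟨rfl, rfl⟩ | ⟨rfl, rfl⟩ <;> rcases ht with ⟨ht, rfl⟩ | ⟨ht, rfl⟩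
      · rfl
      · exact absurd (hc0.trans hcd) ht.not_gt
      · exact absurd (hcd.trans hd1) ht.not_gt
      · rfl
  have hcross : ∀ e ∈ G.edgeSet, ∀ f ∈ G.edgeSet, e ≠ f → ∀ s t, γ e s = γ f t →
      ∃ v, v ∈ e ∧ v ∈ f ∧ D.point v = γ e s := fun e h f h' hef s t hst =>
    D.inter_subset e h f h' hef _ ⟨hγarc e h s, hst ▸ hγarc f h' t⟩
  have hKK : ∀ u v, u ≠ v → Disjoint (K u) (K v) := by
    intro u v huv
    rw [Set.disjoint_left]
    intro z hu hv
    rcases hK u z hu with rfl | ⟨e, h, s, hs, rfl⟩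
    · exact huv (hptK v u hv)
    rcases hK v _ hv with hz | ⟨f, h', t, ht, hst⟩
    · exact huv (hptK u v (hz ▸ hu)).symm
    by_cases hef : e = f
    · subst hef
      obtain rfl := hinj e h hst
      rcases hs with ⟨hs, rfl⟩ | ⟨hs, rfl⟩ <;> rcases ht with ⟨ht, rfl⟩ | ⟨ht, rfl⟩
      · exact huv rfl
      · exact absurd (hs.trans_lt hcd) ht.not_gt
      · exact absurd (ht.trans_lt hcd) hs.not_gt
      · exact huv rfl
    · obtain ⟨w, -, -, hw⟩ := hcross e h f h' hef s t hst.symm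
      exact huv ((hptK u w (hw ▸ hu)).symm.trans (hptK v w (hw ▸ hv)))
  have hMpt : ∀ e ∈ G.edgeSet, ∀ w, D.point w ∉ M e := by
    rintro e h w ⟨t, ⟨ht1, ht2⟩, htw⟩
    rcases hpt e h t w htw with ⟨rfl, -⟩ | ⟨rfl, -⟩
    · exact absurd hc0 ht1.not_gt
    · exact absurd hd1 ht2.not_gt
  have hMM : ∀ e ∈ G.edgeSet, ∀ f ∈ G.edgeSet, e ≠ f → Disjoint (M e) (M f) := by
    intro e h f h' hef
    rw [Set.disjoint_left]
    rintro z ⟨s, hs, rfl⟩ ⟨t, ht, hst⟩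
    obtain ⟨w, -, -, hw⟩ := hcross e h f h' hef s t hst.symm
    exact hMpt e h w ⟨s, hs, hw.symm⟩
  have hMK : ∀ e ∈ G.edgeSet, ∀ v, v ∉ e → Disjoint (M e) (K v) := by
    intro e h v hv
    rw [Set.disjoint_left]
    rintro z ⟨s, hs, rfl⟩ hz
    rcases hK v _ hz with hz | ⟨f, h', t, ht, hst⟩
    · exact hMpt e h v ⟨s, hs, hz⟩
    · by_cases hef : e = f
      · subst hef
        rcases ht with ⟨-, rfl⟩ | ⟨-, rfl⟩ <;> rw [hmem] at hv <;> simp at hv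
      · obtain ⟨w, -, -, hw⟩ := hcross e h f h' hef s t hst.symm
        exact hMpt e h w ⟨s, hs, hw.symm⟩
  have hKcompact : ∀ v, IsCompact (K v) := by
    intro v
    refine isCompact_singleton.union (Set.Finite.isCompact_biUnion (Set.toFinite _) fun e h => ?_)
    refine IsCompact.union (isCompact_iUnion fun _ => ?_) (isCompact_iUnion fun _ => ?_)
    · exact isClosed_Iic.isCompact.image (hcont e h)
    · exact isClosed_Ici.isCompact.image (hcont e h)
  have hMcompact : ∀ e ∈ G.edgeSet, IsCompact (M e) := fun e h =>
    isClosed_Icc.isCompact.image (hcont e h)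
  have hMconn : ∀ e ∈ G.edgeSet, IsPreconnected (M e) := fun e h =>
    isPreconnected_Icc.image _ (hcont e h).continuousOn
  have hKconn : ∀ v, IsPreconnected (K v) := by
    intro v
    refine isPreconnected_of_forall (D.point v) fun z hz => ?_
    rcases hz with hz | hz
    · exact ⟨{D.point v}, Set.subset_union_left, rfl, hz, isPreconnected_singleton⟩
    · simp only [Set.mem_iUnion, Set.mem_union] at hz
      obtain ⟨e, h, ⟨rfl, hz⟩ | ⟨rfl, hz⟩⟩ := hz
      · refine ⟨γ e '' Set.Iic c, fun z hz => Or.inr ?_, ⟨0, hc0.le, h0 e h⟩, hz,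
          isPreconnected_Iic.image _ (hcont e h).continuousOn⟩
        simp only [Set.mem_iUnion, Set.mem_union]
        exact ⟨e, h, Or.inl ⟨rfl, hz⟩⟩
      · refine ⟨γ e '' Set.Ici d, fun z hz => Or.inr ?_, ⟨1, hd1.le, h1 e h⟩, hz,
          isPreconnected_Ici.image _ (hcont e h).continuousOn⟩
        simp only [Set.mem_iUnion, Set.mem_union]
        exact ⟨e, h, Or.inr ⟨rfl, hz⟩⟩
  have hMmeet : ∀ e ∈ G.edgeSet, ∀ v ∈ e, (M e ∩ K v).Nonempty := by
    intro e h v hv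
    rw [hmem] at hv
    rcases hv with rfl | rfl
    · refine ⟨γ e c, ⟨c, ⟨le_rfl, hcd.le⟩, rfl⟩, Or.inr ?_⟩
      simp only [Set.mem_iUnion, Set.mem_union]
      exact ⟨e, h, Or.inl ⟨rfl, c, Set.self_mem_Iic, rfl⟩⟩
    · refine ⟨γ e d, ⟨d, ⟨hcd.le, le_rfl⟩, rfl⟩, Or.inr ?_⟩
      simp only [Set.mem_iUnion, Set.mem_union]
      exact ⟨e, h, Or.inr ⟨rfl, d, Set.self_mem_Ici, rfl⟩⟩
  have hev : ∀ᶠ n : ℝ in Filter.atTop,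
      (∀ u v, u ≠ v → Disjoint (latticeNhd n (K u)) (latticeNhd n (K v))) ∧
      (∀ e ∈ G.edgeSet, ∀ f ∈ G.edgeSet, e ≠ f →
        Disjoint (latticeNhd n (M e)) (latticeNhd n (M f))) ∧
      ∀ e ∈ G.edgeSet, ∀ v, v ∉ e → Disjoint (latticeNhd n (M e)) (latticeNhd n (K v)) := by
    simp only [Filter.eventually_and, Filter.eventually_all]
    exact ⟨fun u v huv => eventually_disjoint_latticeNhd (hKcompact u) (hKcompact v) (hKK u v huv),
      fun e h f h' hef =>
        eventually_disjoint_latticeNhd (hMcompact e h) (hMcompact f h') (hMM e h f h' hef),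
      fun e h v hv =>
        eventually_disjoint_latticeNhd (hMcompact e h) (hKcompact v) (hMK e h v hv)⟩
  obtain ⟨n, hn1, hn2, hn3⟩ := hev.exists
  refine exists_grid_minor_of_links G (fun v => latticeNhd n (K v)) (fun e => latticeNhd n (M e))
    (fun v => finite_latticeNhd n (hKcompact v)) (fun e h => finite_latticeNhd n (hMcompact e h))
    (fun v => gridConnected_latticeNhd n (hKconn v))
    (fun e h => gridConnected_latticeNhd n (hMconn e h)) hn1 hn2 hn3 fun e h v hv => ?_
  obtain ⟨z, hzM, hzK⟩ := hMmeet e h v hv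
  obtain ⟨p, hp⟩ := exists_lattice_point_near n z
  exact ⟨p, ⟨z, hzM, hp⟩, ⟨z, hzK, hp⟩⟩

/-! ### Face boundaries and Euler's inequality -/

/-- The edges on the boundary of the face `φ`: those with `φ` on exactly one side. -/
def faceBoundary {V Φ : Type*} [DecidableEq Φ] (E : Finset (Sym2 V)) (l r : Sym2 V → Φ) (φ : Φ) :
    Finset (Sym2 V) :=
  {e ∈ E | ¬(l e = φ ↔ r e = φ)}

/-- The faces with nonempty boundary. -/
def boundedFaces {V Φ : Type*} [DecidableEq Φ] (E : Finset (Sym2 V)) (l r : Sym2 V → Φ) :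
    Finset Φ :=
  {φ ∈ E.image l ∪ E.image r | (faceBoundary E l r φ).Nonempty}

theorem mem_boundedFaces {V Φ : Type*} [DecidableEq Φ] {E : Finset (Sym2 V)} {l r : Sym2 V → Φ}
    {e : Sym2 V} {φ : Φ} (he : e ∈ faceBoundary E l r φ) : φ ∈ boundedFaces E l r := by
  rw [boundedFaces, Finset.mem_filter]
  refine ⟨?_, e, he⟩
  rw [faceBoundary, Finset.mem_filter] at he
  rw [Finset.mem_union, Finset.mem_image, Finset.mem_image]
  by_cases h : l e = φ
  · exact Or.inl ⟨e, he.1, h⟩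
  · by_cases h' : r e = φ
    · exact Or.inr ⟨e, he.1, h'⟩
    · exact absurd (iff_of_false h h') he.2

/-- A face with empty boundary has `e` on both sides or on neither, so its coefficient vanishes
modulo 2. This allows a finite set of faces to replace `Φ`. -/
theorem sum_boundedFaces {V Φ : Type*} [DecidableEq Φ] {E : Finset (Sym2 V)} (l r : Sym2 V → Φ)
    {e : Sym2 V} (he : e ∈ E) (g : Φ → ZMod 2) :
    ∑ φ ∈ boundedFaces E l r, g φ * ((if l e = φ then 1 else 0) + if r e = φ then 1 else 0) =
      g (l e) + g (r e) := by
  have h1 : ∑ φ ∈ E.image l ∪ E.image r,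
      g φ * ((if l e = φ then 1 else 0) + if r e = φ then 1 else 0) = g (l e) + g (r e) := by
    simp only [mul_add, mul_ite, mul_one, mul_zero, Finset.sum_add_distrib, Finset.sum_ite_eq]
    rw [if_pos (Finset.mem_union_left _ (Finset.mem_image_of_mem l he)),
      if_pos (Finset.mem_union_right _ (Finset.mem_image_of_mem r he))]
  rw [← h1]
  refine Finset.sum_subset (Finset.filter_subset _ _) fun φ _ hφ => ?_
  have h2 : l e = φ ↔ r e = φ := by
    by_contra h
    exact hφ (mem_boundedFaces (Finset.mem_filter.2 ⟨he, h⟩))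
  simp only [h2, CharTwo.add_self_eq_zero, mul_zero]

/-- Double counting: an edge lies on exactly two face boundaries if its sides differ and on none if
they agree. -/
theorem sum_card_filter_faceBoundary {V Φ : Type*} [DecidableEq Φ] (E : Finset (Sym2 V))
    (l r : Sym2 V → Φ) (p : Sym2 V → Prop) [DecidablePred p] :
    ∑ φ ∈ boundedFaces E l r, {e ∈ faceBoundary E l r φ | p e}.card +
      2 * {e ∈ {e ∈ E | l e = r e} | p e}.card = 2 * {e ∈ E | p e}.card := by
  have h1 : ∀ φ, {e ∈ faceBoundary E l r φ | p e} =
      {e ∈ {e ∈ E | p e} | ¬(l e = φ ↔ r e = φ)} := by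
    intro φ
    rw [faceBoundary, Finset.filter_comm]
  have h2 := Finset.sum_card_bipartiteAbove_eq_sum_card_bipartiteBelow
    (s := boundedFaces E l r) (t := {e ∈ E | p e}) (fun φ e => ¬(l e = φ ↔ r e = φ))
  simp only [Finset.bipartiteAbove, Finset.bipartiteBelow] at h2
  simp only [h1]
  rw [h2, Finset.filter_comm, Finset.card_filter _ {e ∈ E | p e}, Finset.mul_sum,
    ← Finset.sum_add_distrib, mul_comm]
  refine Finset.sum_const_nat fun e he => ?_
  by_cases hlr : l e = r e
  · simp [hlr]
  · have : {φ ∈ boundedFaces E l r | ¬(l e = φ ↔ r e = φ)} = {l e, r e} := by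
      ext φ
      simp only [Finset.mem_filter, Finset.mem_insert, Finset.mem_singleton]
      constructor
      · rintro ⟨-, h⟩
        by_contra h'
        push Not at h'
        exact h (iff_of_false h'.1.symm h'.2.symm)
      · intro h
        have hφ : ¬(l e = φ ↔ r e = φ) := by
          rcases h with rfl | rfl
          · simpa using Ne.symm hlr
          · simpa using hlr
        exact ⟨mem_boundedFaces (e := e)
          (Finset.mem_filter.2 ⟨(Finset.mem_filter.1 he).1, hφ⟩), hφ⟩
    rw [this, Finset.card_pair hlr, if_neg hlr, mul_zero, add_zero]

/-- Euler's inequality: if every even subgraph is a sum of face boundaries, then there are at least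
`|E| - |V| + 2` faces. -/
theorem card_edges_add_two_le {V Φ : Type*} [Fintype V] [Nonempty V] [DecidableEq V]
    [DecidableEq Φ] (E : Finset (Sym2 V)) (hE : ∀ e ∈ E, ¬ e.IsDiag) (l r : Sym2 V → Φ)
    (hspan : ∀ z : Sym2 V → ZMod 2, (∀ v, ∑ e ∈ E with v ∈ e, z e = 0) →
      ∃ g : Φ → ZMod 2, ∀ e ∈ E, z e = g (l e) + g (r e))
    (hcard : Fintype.card V ≤ E.card) :
    E.card + 2 ≤ Fintype.card V + (boundedFaces E l r).card := by
  let F := boundedFaces E l r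
  -- The maps `D`, `δ`, `σ` go from faces to edges to vertices to scalars. The count uses `ker δ ≤
  -- range D`, `range δ ≤ ker σ` and a nonzero kernel of `D`; connectedness of the graph is not
  -- needed.
  let D : (F → ZMod 2) →ₗ[ZMod 2] (E → ZMod 2) := LinearMap.pi fun e =>
    ∑ φ : F, ((if l e = φ then 1 else 0) + if r e = φ then (1 : ZMod 2) else 0) • LinearMap.proj φ
  have hD (g : Φ → ZMod 2) (e : E) : D (fun φ => g φ) e = g (l e) + g (r e) := by
    rw [← sum_boundedFaces l r e.2 g, ← Finset.sum_coe_sort]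
    simp only [D, LinearMap.pi_apply, LinearMap.sum_apply, LinearMap.smul_apply,
      LinearMap.proj_apply, smul_eq_mul]
    exact Finset.sum_congr rfl fun φ _ => mul_comm _ _
  let δ : (E → ZMod 2) →ₗ[ZMod 2] (V → ZMod 2) := LinearMap.pi fun v =>
    ∑ e : E, (if v ∈ (e : Sym2 V) then (1 : ZMod 2) else 0) • LinearMap.proj e
  have hδ (z : Sym2 V → ZMod 2) (v : V) : δ (fun e => z e) v = ∑ e ∈ E with v ∈ e, z e := by
    rw [Finset.sum_filter, ← Finset.sum_coe_sort E]
    simp only [δ, LinearMap.pi_apply, LinearMap.sum_apply, LinearMap.smul_apply,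
      LinearMap.proj_apply, smul_eq_mul, ite_mul, one_mul, zero_mul]
  let σ : (V → ZMod 2) →ₗ[ZMod 2] ZMod 2 := ∑ v, LinearMap.proj v
  have hσ (x : V → ZMod 2) : σ x = ∑ v, x v := by simp [σ]
  have hσδ : LinearMap.range δ ≤ LinearMap.ker σ := by
    rintro _ ⟨z, rfl⟩
    rw [LinearMap.mem_ker, hσ]
    simp only [δ, LinearMap.pi_apply, LinearMap.sum_apply, LinearMap.smul_apply,
      LinearMap.proj_apply, smul_eq_mul]
    rw [Finset.sum_comm]
    refine Finset.sum_eq_zero fun e _ => ?_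
    rw [← Finset.sum_mul]
    obtain ⟨e, he⟩ := e
    have hd := hE e he
    induction e using Sym2.ind with
    | _ a b =>
      rw [Sym2.mk_isDiag_iff] at hd
      have : ∑ v, (if v ∈ s(a, b) then (1 : ZMod 2) else 0) = 0 := by
        rw [← Finset.sum_filter]
        have : (Finset.univ.filter fun v => v ∈ s(a, b)) = {a, b} := by ext; simp
        rw [this, Finset.sum_pair hd]
        rfl
      rw [this, zero_mul]
  have hσsurj : Function.Surjective σ := by
    obtain ⟨v⟩ := ‹Nonempty V›
    exact fun c => ⟨Pi.single v c, by rw [hσ, Finset.sum_pi_single']; simp⟩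
  have r1 := LinearMap.finrank_range_add_finrank_ker σ
  rw [LinearMap.range_eq_top.2 hσsurj, finrank_top, Module.finrank_self,
    Module.finrank_fintype_fun_eq_card] at r1
  have r2 := LinearMap.finrank_range_add_finrank_ker δ
  rw [Module.finrank_fintype_fun_eq_card, Fintype.card_coe] at r2
  have r3 := LinearMap.finrank_range_add_finrank_ker D
  rw [Module.finrank_fintype_fun_eq_card, Fintype.card_coe] at r3
  have r4 := Submodule.finrank_mono hσδ
  have hker : LinearMap.ker δ ≤ LinearMap.range D := by
    intro z hz
    let z' : Sym2 V → ZMod 2 := fun e => if h : e ∈ E then z ⟨e, h⟩ else 0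
    have hz' : (fun e : E => z' e) = z := by ext e; simp [z']
    obtain ⟨g, hg⟩ := hspan z' fun v => by
      rw [← hδ, hz', LinearMap.mem_ker.1 hz]
      rfl
    refine ⟨fun φ => g φ, ?_⟩
    rw [← hz']
    ext e
    rw [hD, hg e e.2]
  have r5 := Submodule.finrank_mono hker
  -- Constant functions on faces lie in `ker D`. There is at least one face, since `|V| ≤ |E|` makes
  -- `ker δ`, and with it `range D`, nonzero.
  have r6 : 0 < Module.finrank (ZMod 2) (LinearMap.ker D) := by
    have hF : Nonempty F := by
      rw [← Fintype.card_pos_iff, Fintype.card_coe]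
      by_contra h
      change ¬ 0 < F.card at h
      omega
    obtain ⟨φ⟩ := hF
    rw [Module.finrank_pos_iff_exists_ne_zero]
    refine ⟨⟨fun _ => 1, ?_⟩, fun h => ?_⟩
    · rw [LinearMap.mem_ker]
      ext e
      rw [hD (fun _ => 1) e]
      rfl
    · exact one_ne_zero (congrFun (congrArg Subtype.val h) φ)
  change E.card + 2 ≤ Fintype.card V + F.card
  omega

/-! ### Inner and outer edges, and the excess of a face -/

/-- The edges of `X` at `t` with both ends in `T`. -/
def innerEdgesAt {V : Type*} [DecidableEq V] (T : Finset V) (X : Finset (Sym2 V)) (t : V) :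
    Finset (Sym2 V) :=
  {e ∈ X | t ∈ e ∧ e ∈ T.sym2}

/-- The edges of `X` at `t` with an end outside `T`. -/
def outerEdgesAt {V : Type*} [DecidableEq V] (T : Finset V) (X : Finset (Sym2 V)) (t : V) :
    Finset (Sym2 V) :=
  {e ∈ X | t ∈ e ∧ e ∉ T.sym2}

/-- An edge with exactly one end in `T`, for a set `T` that meets every edge. -/
theorem exists_eq_mk_of_notMem_sym2 {V : Type*} {T : Finset V} {e : Sym2 V} (hT : ∃ t ∈ e, t ∈ T)
    (he : e ∉ T.sym2) : ∃ t w, e = s(t, w) ∧ t ∈ T ∧ w ∉ T := by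
  obtain ⟨t, hte, ht⟩ := hT
  obtain ⟨w, rfl⟩ := Sym2.mem_iff_exists.1 hte
  rw [Finset.mk_mem_sym2_iff] at he
  exact ⟨t, w, rfl, ht, fun hw => he ⟨ht, hw⟩⟩

section

variable {V : Type*} [DecidableEq V]

theorem card_innerEdgesAt_add_card_outerEdgesAt (T : Finset V) (X : Finset (Sym2 V)) (t : V) :
    (innerEdgesAt T X t).card + (outerEdgesAt T X t).card = {e ∈ X | t ∈ e}.card := by
  rw [← Finset.card_filter_add_card_filter_not (s := {e ∈ X | t ∈ e}) (fun e => e ∈ T.sym2),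
    Finset.filter_filter, Finset.filter_filter]
  rfl

theorem sum_card_filter_mem_sym2 (T : Finset V) (X : Finset (Sym2 V)) (p : Sym2 V → Prop)
    [DecidablePred p] (k : ℕ) (h : ∀ e ∈ X, p e → {t ∈ T | t ∈ e}.card = k) :
    ∑ t ∈ T, {e ∈ X | t ∈ e ∧ p e}.card = k * {e ∈ X | p e}.card := by
  have h1 : ∀ t, {e ∈ X | t ∈ e ∧ p e} = {e ∈ {e ∈ X | p e} | t ∈ e} := by
    intro t
    rw [Finset.filter_filter]
    exact Finset.filter_congr fun e _ => and_comm
  simp only [h1]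
  have h2 := Finset.sum_card_bipartiteAbove_eq_sum_card_bipartiteBelow
    (s := T) (t := {e ∈ X | p e}) (fun t e => t ∈ e)
  simp only [Finset.bipartiteAbove, Finset.bipartiteBelow] at h2
  rw [h2, mul_comm]
  refine Finset.sum_const_nat fun e he => ?_
  rw [Finset.mem_filter] at he
  exact h e he.1 he.2

theorem sum_card_innerEdgesAt (T : Finset V) (X : Finset (Sym2 V)) (hX : ∀ e ∈ X, ¬ e.IsDiag) :
    ∑ t ∈ T, (innerEdgesAt T X t).card = 2 * {e ∈ X | e ∈ T.sym2}.card := by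
  refine sum_card_filter_mem_sym2 T X _ 2 fun e he heT => ?_
  have hd := hX e he
  induction e using Sym2.ind with
  | _ a b =>
    rw [Sym2.mk_isDiag_iff] at hd
    rw [Finset.mk_mem_sym2_iff] at heT
    have : {t ∈ T | t ∈ s(a, b)} = {a, b} := by
      ext t
      simp only [Finset.mem_filter, Sym2.mem_iff, Finset.mem_insert, Finset.mem_singleton]
      refine ⟨And.right, fun h => ⟨?_, h⟩⟩
      rcases h with rfl | rfl
      exacts [heT.1, heT.2]
    rw [this, Finset.card_pair hd]

theorem sum_card_outerEdgesAt (T : Finset V) (X : Finset (Sym2 V))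
    (hT : ∀ e ∈ X, ∃ t ∈ e, t ∈ T) :
    ∑ t ∈ T, (outerEdgesAt T X t).card = {e ∈ X | e ∉ T.sym2}.card := by
  rw [← one_mul (Finset.card _)]
  refine sum_card_filter_mem_sym2 T X _ 1 fun e he heT => ?_
  obtain ⟨t, w, rfl, ht, hw⟩ := exists_eq_mk_of_notMem_sym2 (hT e he) heT
  rw [Finset.card_eq_one]
  refine ⟨t, ?_⟩
  ext x
  simp only [Finset.mem_filter, Sym2.mem_iff, Finset.mem_singleton]
  constructor
  · rintro ⟨hx, rfl | rfl⟩
    exacts [rfl, absurd hx hw]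
  · rintro rfl
    exact ⟨ht, Or.inl rfl⟩

theorem sum_card_compl (T : Finset V) [Fintype V] (X : Finset (Sym2 V))
    (hT : ∀ e ∈ X, ∃ t ∈ e, t ∈ T) :
    ∑ w ∈ Tᶜ, {e ∈ X | w ∈ e}.card = {e ∈ X | e ∉ T.sym2}.card := by
  rw [← one_mul (Finset.card _),
    ← sum_card_filter_mem_sym2 Tᶜ X (fun e => e ∉ T.sym2) 1 fun e he heT => ?_]
  · refine Finset.sum_congr rfl fun w hw => ?_
    congr 1
    refine Finset.filter_congr fun e _ => ⟨fun h => ⟨h, fun h' => ?_⟩, And.left⟩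
    exact Finset.mem_compl.1 hw (Finset.mem_sym2_iff.1 h' w h)
  · obtain ⟨t, w, rfl, ht, hw⟩ := exists_eq_mk_of_notMem_sym2 (hT e he) heT
    rw [Finset.card_eq_one]
    refine ⟨w, ?_⟩
    ext x
    simp only [Finset.mem_filter, Finset.mem_compl, Sym2.mem_iff, Finset.mem_singleton]
    constructor
    · rintro ⟨hx, rfl | rfl⟩
      exacts [absurd ht hx, rfl]
    · rintro rfl
      exact ⟨hw, Or.inr rfl⟩

theorem exists_ne_of_even {F : Finset (Sym2 V)} (heven : ∀ v, Even {e ∈ F | v ∈ e}.card)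
    {e : Sym2 V} (he : e ∈ F) {v : V} (hv : v ∈ e) : ∃ f ∈ F, v ∈ f ∧ f ≠ e := by
  have hmem : e ∈ {e ∈ F | v ∈ e} := Finset.mem_filter.2 ⟨he, hv⟩
  have hpos := Finset.card_pos.2 ⟨e, hmem⟩
  have h1 : 1 < {e ∈ F | v ∈ e}.card := by
    obtain ⟨k, hk⟩ := heven v
    omega
  obtain ⟨f, hf, hfe⟩ := Finset.exists_mem_ne h1 e
  rw [Finset.mem_filter] at hf
  exact ⟨f, hf.1, hf.2, hfe⟩

/-- A nonempty even subgraph has at least three edges. -/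
theorem three_le_card_of_even {F : Finset (Sym2 V)} (hF : ∀ e ∈ F, ¬ e.IsDiag)
    (heven : ∀ v, Even {e ∈ F | v ∈ e}.card) (hne : F.Nonempty) : 3 ≤ F.card := by
  obtain ⟨e, he⟩ := hne
  induction e using Sym2.ind with
  | _ u v =>
    have huv : u ≠ v := fun h => hF _ he (Sym2.mk_isDiag_iff.2 h)
    obtain ⟨f, hf, hvf, hfe⟩ := exists_ne_of_even heven he (Sym2.mem_mk_right u v)
    obtain ⟨g, hg, hug, hge⟩ := exists_ne_of_even heven he (Sym2.mem_mk_left u v)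
    refine Finset.two_lt_card.2 ⟨_, he, f, hf, g, hg, hfe.symm, hge.symm, ?_⟩
    rintro rfl
    exact hfe ((Sym2.mem_and_mem_iff huv).1 ⟨hug, hvf⟩)

/-- By parity `t` has two outer edges, to distinct `w` and `w'` outside `T`. Each of these has a
further edge, and the two further edges differ because no edge joins `w` to `w'`. -/
theorem four_le_card_of_even {T : Finset V} {F : Finset (Sym2 V)}
    (hT : ∀ e ∈ F, ∃ t ∈ e, t ∈ T) (heven : ∀ v, Even {e ∈ F | v ∈ e}.card) {t : V} (ht : t ∈ T)
    (hlt : (innerEdgesAt T F t).card < (outerEdgesAt T F t).card) : 4 ≤ F.card := by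
  have h2 : 1 < (outerEdgesAt T F t).card := by
    have h := card_innerEdgesAt_add_card_outerEdgesAt T F t
    obtain ⟨k, hk⟩ := heven t
    omega
  obtain ⟨e, he, e', he', hee'⟩ := Finset.one_lt_card.1 h2
  have key : ∀ e ∈ outerEdgesAt T F t, ∃ w, e = s(t, w) ∧ w ∉ T ∧ e ∈ F := by
    intro e he
    rw [outerEdgesAt, Finset.mem_filter] at he
    obtain ⟨w, rfl⟩ := Sym2.mem_iff_exists.1 he.2.1
    exact ⟨w, rfl, fun hw => he.2.2 (Finset.mk_mem_sym2_iff.2 ⟨ht, hw⟩), he.1⟩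
  obtain ⟨w, rfl, hw, heF⟩ := key e he
  obtain ⟨w', rfl, hw', heF'⟩ := key e' he'
  have hww' : w ≠ w' := fun h => hee' (h ▸ rfl)
  obtain ⟨f, hf, hwf, hfe⟩ := exists_ne_of_even heven heF (Sym2.mem_mk_right t w)
  obtain ⟨f', hf', hwf', hfe'⟩ := exists_ne_of_even heven heF' (Sym2.mem_mk_right t w')
  have hff' : f ≠ f' := by
    rintro rfl
    have := (Sym2.mem_and_mem_iff hww').1 ⟨hwf, hwf'⟩
    obtain ⟨x, hx, hxT⟩ := hT f hf
    rw [this, Sym2.mem_iff] at hx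
    rcases hx with rfl | rfl
    exacts [hw hxT, hw' hxT]
  have h1 : f ≠ s(t, w') := by
    rintro rfl
    rcases Sym2.mem_iff.1 hwf with rfl | rfl
    exacts [hw ht, hww' rfl]
  have h2 : f' ≠ s(t, w) := by
    rintro rfl
    rcases Sym2.mem_iff.1 hwf' with rfl | rfl
    exacts [hw' ht, hww' rfl]
  have hsub : ({s(t, w), s(t, w'), f, f'} : Finset (Sym2 V)) ⊆ F := by
    intro x hx
    simp only [Finset.mem_insert, Finset.mem_singleton] at hx
    rcases hx with rfl | rfl | rfl | rfl <;> assumption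
  refine le_trans (Eq.ge ?_) (Finset.card_le_card hsub)
  rw [Finset.card_insert_of_notMem, Finset.card_insert_of_notMem, Finset.card_pair hff']
  · simp only [Finset.mem_insert, Finset.mem_singleton, not_or]
    exact ⟨h1.symm, hfe'.symm⟩
  · simp only [Finset.mem_insert, Finset.mem_singleton, not_or]
    exact ⟨hee', hfe.symm, h2.symm⟩

/-- If some excess is positive, then `|F| ≥ 4` and the total is at most the number of outer edges,
so at most `|F| ≤ 4|F| - 12`. Otherwise the total is 0 and `|F| ≥ 3` suffices. -/
theorem sum_outer_sub_inner_add_le {T : Finset V} {F : Finset (Sym2 V)}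
    (hF : ∀ e ∈ F, ¬ e.IsDiag) (hT : ∀ e ∈ F, ∃ t ∈ e, t ∈ T)
    (heven : ∀ v, Even {e ∈ F | v ∈ e}.card) (hne : F.Nonempty) :
    ∑ t ∈ T, ((outerEdgesAt T F t).card - (innerEdgesAt T F t).card) + 12 ≤ 4 * F.card := by
  by_cases h : ∃ t ∈ T, (innerEdgesAt T F t).card < (outerEdgesAt T F t).card
  · obtain ⟨t, ht, hlt⟩ := h
    have h4 := four_le_card_of_even hT heven ht hlt
    have h1 : ∑ t ∈ T, ((outerEdgesAt T F t).card - (innerEdgesAt T F t).card) ≤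
        ∑ t ∈ T, (outerEdgesAt T F t).card := Finset.sum_le_sum fun t _ => Nat.sub_le _ _
    rw [sum_card_outerEdgesAt T F hT] at h1
    have h2 := Finset.card_filter_le F fun e => e ∉ T.sym2
    omega
  · push Not at h
    rw [Finset.sum_eq_zero fun t ht => Nat.sub_eq_zero_of_le (h t ht)]
    have := three_le_card_of_even hF heven hne
    omega

theorem even_card_faceBoundary {Φ : Type*} [DecidableEq Φ] (E : Finset (Sym2 V))
    (l r : Sym2 V → Φ)
    (heven : ∀ (χ : Φ → ZMod 2) (v : V), ∑ e ∈ E with v ∈ e, (χ (l e) + χ (r e)) = 0)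
    (φ : Φ) (v : V) : Even {e ∈ faceBoundary E l r φ | v ∈ e}.card := by
  rw [← ZMod.natCast_eq_zero_iff_even, ← heven (fun ψ => if ψ = φ then 1 else 0) v, faceBoundary,
    Finset.filter_comm, Finset.card_filter, Nat.cast_sum]
  refine Finset.sum_congr rfl fun e _ => ?_
  by_cases h1 : l e = φ <;> by_cases h2 : r e = φ <;> simp [h1, h2, CharTwo.add_self_eq_zero]

/-! ### Discharging and the main theorem -/

/-- Discharging: in a graph with a system of faces, some terminal has few inner and few outer
edges. -/
theorem exists_card_innerEdgesAt_le [Fintype V] [Nonempty V] {Φ : Type*} [DecidableEq Φ]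
    (E : Finset (Sym2 V)) (hE : ∀ e ∈ E, ¬ e.IsDiag) (l r : Sym2 V → Φ)
    (heven : ∀ (χ : Φ → ZMod 2) (v : V), ∑ e ∈ E with v ∈ e, (χ (l e) + χ (r e)) = 0)
    (hspan : ∀ z : Sym2 V → ZMod 2, (∀ v, ∑ e ∈ E with v ∈ e, z e = 0) →
      ∃ g : Φ → ZMod 2, ∀ e ∈ E, z e = g (l e) + g (r e))
    (T : Finset V) (hT : ∀ e ∈ E, ∃ t ∈ e, t ∈ T) (hdeg : ∀ v, 3 ≤ {e ∈ E | v ∈ e}.card) :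
    ∃ t ∈ T, (innerEdgesAt T E t).card ≤ 5 ∧ (outerEdgesAt T E t).card ≤ 5 := by
  by_contra! hbad
  let N : Finset (Sym2 V) := {e ∈ E | l e = r e}
  let F := boundedFaces E l r
  let β := faceBoundary E l r
  have hβE : ∀ φ, β φ ⊆ E := fun φ => Finset.filter_subset _ _
  -- With six inner edges the first term suffices. With six outer edges, the right side is at least
  -- twice the outer degree; the last term accounts for outer edges with the same face on both
  -- sides.
  have hpoint : ∀ t ∈ T, 12 ≤ 2 * (innerEdgesAt T E t).card +
      ∑ φ ∈ F, ((outerEdgesAt T (β φ) t).card - (innerEdgesAt T (β φ) t).card) +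
      2 * (outerEdgesAt T N t).card := by
    intro t ht
    have h1 := sum_card_filter_faceBoundary E l r fun e => t ∈ e ∧ e ∈ T.sym2
    have h2 := sum_card_filter_faceBoundary E l r fun e => t ∈ e ∧ e ∉ T.sym2
    have h3 : ∑ φ ∈ F, (outerEdgesAt T (β φ) t).card ≤ ∑ φ ∈ F, (innerEdgesAt T (β φ) t).card +
        ∑ φ ∈ F, ((outerEdgesAt T (β φ) t).card - (innerEdgesAt T (β φ) t).card) := by
      rw [← Finset.sum_add_distrib]
      exact Finset.sum_le_sum fun φ _ => by omega
    have h4 := hbad t ht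
    change ∑ φ ∈ F, (innerEdgesAt T (β φ) t).card + 2 * (innerEdgesAt T N t).card =
      2 * (innerEdgesAt T E t).card at h1
    change ∑ φ ∈ F, (outerEdgesAt T (β φ) t).card + 2 * (outerEdgesAt T N t).card =
      2 * (outerEdgesAt T E t).card at h2
    omega
  have hsum := Finset.sum_le_sum hpoint
  rw [Finset.sum_const, smul_eq_mul, Finset.sum_add_distrib, Finset.sum_add_distrib,
    ← Finset.mul_sum, ← Finset.mul_sum, sum_card_innerEdgesAt T E hE,
    sum_card_outerEdgesAt T N fun e he => hT e (Finset.mem_filter.1 he).1, Finset.sum_comm] at hsum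
  have hfaces : ∑ φ ∈ F, (∑ t ∈ T,
      ((outerEdgesAt T (β φ) t).card - (innerEdgesAt T (β φ) t).card) + 12) ≤
      ∑ φ ∈ F, 4 * (β φ).card :=
    Finset.sum_le_sum fun φ hφ => sum_outer_sub_inner_add_le (fun e he => hE e (hβE φ he))
      (fun e he => hT e (hβE φ he)) (even_card_faceBoundary E l r heven φ)
      (Finset.mem_filter.1 hφ).2
  rw [Finset.sum_add_distrib, Finset.sum_const, smul_eq_mul, ← Finset.mul_sum] at hfaces
  have hedges := sum_card_filter_faceBoundary E l r fun _ => True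
  simp only [Finset.filter_true] at hedges
  change ∑ φ ∈ F, (β φ).card + 2 * N.card = 2 * E.card at hedges
  have hN := Finset.card_filter_le N fun e => e ∉ T.sym2
  have hW := Finset.card_nsmul_le_sum Tᶜ (fun w => {e ∈ E | w ∈ e}.card) 3 fun w _ => hdeg w
  rw [sum_card_compl T E hT, smul_eq_mul] at hW
  have hsplit := Finset.card_filter_add_card_filter_not (s := E) (fun e => e ∈ T.sym2)
  have hV := Finset.card_add_card_compl T
  have hcard : Fintype.card V ≤ E.card := by
    have h1 := Finset.card_nsmul_le_sum Finset.univ (fun v => {e ∈ E | v ∈ e}.card) 3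
      fun v _ => hdeg v
    -- With all vertices as terminals every edge is inner, and this is the handshake lemma.
    have h2 := sum_card_innerEdgesAt Finset.univ E hE
    simp only [innerEdgesAt, Finset.sym2_univ, Finset.mem_univ, and_true, Finset.filter_true] at h2
    rw [h2, smul_eq_mul, Finset.card_univ] at h1
    omega
  have heuler : E.card + 2 ≤ Fintype.card V + F.card :=
    card_edges_add_two_le E hE l r hspan hcard
  omega

end

theorem mainTheorem9 {V : Type*} [Fintype V] (G : SimpleGraph V) [DecidableRel G.Adj]
    (T W : Set V) (hTW : IsCompl T W)
    (hplanar : IsPlanarGraph G)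
    (hdeg : 3 ≤ G.minDegree)
    (hW : G.IsIndepSet W) :
    ∃ t ∈ T, G.degree t ≤ 10 ∧ (G.neighborSet t ∩ T).ncard ≤ 5 := by
  classical
  -- On an empty vertex set the minimum degree is 0 by convention.
  have hV : Nonempty V := by
    by_contra h
    rw [not_nonempty_iff] at h
    simp at hdeg
  obtain ⟨B, hfin, hconn, hdisj, hadj⟩ := hplanar.exists_grid_minor
  obtain ⟨Φ, l, r, heven, hspan⟩ := exists_faces_of_grid_minor G B hfin hconn hdisj hadj
  have hdegree : ∀ v, {e ∈ G.edgeFinset | v ∈ e}.card = G.degree v := by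
    intro v
    rw [← SimpleGraph.incidenceFinset_eq_filter, SimpleGraph.card_incidenceFinset_eq_degree]
  obtain ⟨t, ht, hin, hout⟩ := exists_card_innerEdgesAt_le G.edgeFinset
    (fun e he => G.not_isDiag_of_mem_edgeFinset he) l r heven
    (fun z hz => by simpa only [SimpleGraph.mem_edgeFinset] using hspan z hz) T.toFinset
    (fun e he => by
      induction e using Sym2.ind with
      | _ a b =>
        rw [SimpleGraph.mem_edgeFinset, SimpleGraph.mem_edgeSet] at he
        have hcover : ∀ v, v ∉ T → v ∈ W := fun v hv => by
          rw [← hTW.compl_eq]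
          exact hv
        by_cases ha : a ∈ T
        · exact ⟨a, Sym2.mem_mk_left a b, Set.mem_toFinset.2 ha⟩
        · refine ⟨b, Sym2.mem_mk_right a b, Set.mem_toFinset.2 ?_⟩
          by_contra hb
          exact hW (hcover a ha) (hcover b hb) he.ne he)
    (fun v => hdegree v ▸ hdeg.trans (G.minDegree_le_degree v))
  refine ⟨t, Set.mem_toFinset.1 ht, ?_, ?_⟩
  · rw [← hdegree, ← card_innerEdgesAt_add_card_outerEdgesAt T.toFinset]
    omega
  · refine le_trans ?_ hin
    rw [Set.ncard_eq_toFinset_card']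
    refine Finset.card_le_card_of_injOn (fun x => s(t, x)) (fun x hx => ?_) fun x _ y _ hxy => ?_
    · rw [Set.coe_toFinset] at hx
      rw [Finset.mem_coe, innerEdgesAt, Finset.mem_filter, SimpleGraph.mem_edgeFinset,
        Finset.mk_mem_sym2_iff, Set.mem_toFinset, Set.mem_toFinset]
      exact ⟨hx.1, Sym2.mem_mk_left t x, Set.mem_toFinset.1 ht, hx.2⟩
    · exact Sym2.congr_right.1 hxy
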